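/- For $n\ge 0$, the $n$-qubit Clifford group is the group of unitaries on $(\mathbb C^2)^{\otimes n}$ generated by the gates $S=\begin{pmatrix}1&0\\0&i\end{pmatrix}$ and $H=\frac1{\sqrt2}\begin{pmatrix}1&1\\1&-1\end{pmatrix}$ on any qubit and $CX$ (controlled-NOT) on any ordered pair of distinct qubits. A stabilizer state is a vector $C|0^n\rangle$ with $C$ in the Clifford group. For a unit vector $|\phi\rangle\in(\mathbb C^2)^{\otimes n}$, its stabilizer fidelity is $F(\phi)=\max_{s}|\langle s|\phi\rangle|^2$, where $s$ ranges over the $n$-qubit stabilizer states, and its stabilizer rank $\chi(\phi)$ is the smallest $k$ such that $|\phi\rangle=\sum_{i=1}^k\alpha_i|s_i\rangle$ for some $\alpha_i\in\mathbb C$ and stabilizer states $|s_i\rangle$. **Theorem.** (i) Let $|\phi\rangle$ and $|\psi\rangle$ be unit vectors in $(\mathbb C^2)^{\otimes n}$, let $F=F(\phi)$ and $k=\chi(\psi)$. Then $F>0$ and $$\frac{|\langle\phi|\psi\rangle|}{\sqrt F}\le\sqrt e\,(2k)^{\frac{2k+1}2}.$$ (ii) If $|\langle\phi|\psi\rangle|/\sqrt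 F=2^{\Omega(n)}$, then $k=\Omega(n/\log n)$. Precisely: for every $c>0$ there is $c'>0$, depending only on $c$, such that for all $n\ge2$ and all unit vectors $|\phi\rangle,|\psi\rangle\in(\mathbb C^2)^{\otimes n}$ with $|\langle\phi|\psi\rangle|/\sqrt{F(\phi)}\ge 2^{cn}$ we have $\chi(\psi)\ge c'\,n/\log n$. -/

import Mathlib

namespace Stabilizer

noncomputable section

/-- Bit strings of length `n`, the labels of the computational basis. -/
abbrev Bits (n : ℕ) : Type := Fin n → Fin 2

/-- The Hilbert space `(ℂ²)^{⊗ n}` of `n` qubits, in the computational basis. -/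
abbrev Qubits (n : ℕ) : Type := EuclideanSpace ℂ (Bits n)

/-- The operator that acts as the one-qubit matrix `U` on qubit `i`
and as the identity on the other qubits. -/
def onQubit {n : ℕ} (U : Matrix (Fin 2) (Fin 2) ℂ) (i : Fin n) :
    Matrix (Bits n) (Bits n) ℂ :=
  Matrix.of fun x y => if ∀ j, j ≠ i → x j = y j then U (x i) (y i) else 0

/-- The phase gate. -/
def gateS : Matrix (Fin 2) (Fin 2) ℂ := !![1, 0; 0, Complex.I]

/-- The Hadamard gate. -/
def gateH : Matrix (Fin 2) (Fin 2) ℂ := ((1 / Real.sqrt 2 : ℝ) : ℂ) • !![1, 1; 1, -1]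

/-- The controlled-NOT gate with control `i` and target `j`: it maps the basis vector `|y⟩` to
`|x⟩`, where `x` is `y` with its `j`-th bit replaced by `y i + y j` modulo 2. -/
def gateCX {n : ℕ} (i j : Fin n) : Matrix (Bits n) (Bits n) ℂ :=
  Matrix.of fun x y => if x = Function.update y j (y i + y j) then 1 else 0

/-- The `n`-qubit Clifford group: the group of unitaries generated by the gates `S` and `H` on all
qubits and `CX` on all ordered pairs of distinct qubits. -/
def cliffordGroup (n : ℕ) : Subgroup (Matrix.unitaryGroup (Bits n) ℂ) :=
  Subgroup.closure
    {U | (∃ i, (U : Matrix (Bits n) (Bits n) ℂ) = onQubit gateS i) ∨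
      (∃ i, (U : Matrix (Bits n) (Bits n) ℂ) = onQubit gateH i) ∨
      (∃ i j, i ≠ j ∧ (U : Matrix (Bits n) (Bits n) ℂ) = gateCX i j)}

/-- The basis vector `|0ⁿ⟩`. -/
def zeroState (n : ℕ) : Qubits n := EuclideanSpace.single 0 1

/-- Stabilizer states are the vectors `C |0ⁿ⟩` with `C` a Clifford unitary. -/
def IsStabilizerState {n : ℕ} (s : Qubits n) : Prop :=
  ∃ C ∈ cliffordGroup n,
    s = WithLp.toLp 2 ((C : Matrix (Bits n) (Bits n) ℂ).mulVec (zeroState n).ofLp)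

/-- The stabilizer rank: the smallest number of terms in a representation as a complex linear
combination of stabilizer states. -/
def stabilizerRank {n : ℕ} (ψ : Qubits n) : ℕ :=
  sInf {k : ℕ | ∃ (α : Fin k → ℂ) (s : Fin k → Qubits n),
    (∀ i, IsStabilizerState (s i)) ∧ ψ = ∑ i, α i • s i}

/-- The stabilizer fidelity: the largest squared overlap with a stabilizer state. -/
def stabilizerFidelity {n : ℕ} (φ : Qubits n) : ℝ :=
  sSup {r : ℝ | ∃ s : Qubits n, IsStabilizerState s ∧ r = ‖inner ℂ s φ‖ ^ 2}

end

end Stabilizer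

/-! Everything follows from a bound on the coefficients of a shortest decomposition `ψ = ∑ αᵢ sᵢ`:
since `|⟨φ|sᵢ⟩| ≤ √F`, the overlap `|⟨φ|ψ⟩|` is at most `√F ∑ |αᵢ|`.

The source of the bound is arithmetic. Up to phase, Clifford gates preserve the complex Barnes–Wall
lattice, so every stabilizer state, times a scalar of modulus `2 ^ (n / 2)`, is a lattice vector
(`IsStabilizerState.exists_smul_mem_barnesWall`). That is also a lower bound for the lengths of
nonzero lattice vectors (`two_pow_le_of_mem_barnesWall`). The `sᵢ` are independent by minimality of
the rank, so after rephasing every nonzero Gaussian-integer combination of them has norm at least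
one.

Minkowski's theorem turns this into a bound (`normSq_coeff_le`). The set of `β` with `‖∑ βᵢ sᵢ‖ < 1`
has no nonzero Gaussian-integer point, so its volume is at most `4 ^ k`. It contains the image of
the `ℓ¹` ball under the map sending `eⱼ` to `α` and fixing the other `eᵢ`, of volume `|αⱼ|² (2π)^k /
(2k)!`. -/

namespace Stabilizer

/-! ### Geometry of numbers over the Gaussian integers -/

open MeasureTheory

/-- The real basis of `ℂ^ι` made of the vectors `e_i` and `I • e_i`. -/
noncomputable def gaussianBasis (ι : Type*) [Fintype ι] :
    Module.Basis (Σ _ : ι, Fin 2) ℝ (ι → ℂ) :=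
  Pi.basis fun _ => Complex.basisOneI

theorem volume_fundamentalDomain_gaussianBasis (ι : Type*) [Fintype ι] :
    volume (ZSpan.fundamentalDomain (gaussianBasis ι)) = 1 := by
  have h : ZSpan.fundamentalDomain (gaussianBasis ι) =
      Set.univ.pi fun _ => Complex.measurableEquivPi ⁻¹' (Set.univ.pi fun _ => Set.Ico 0 1) := by
    ext
    simp [gaussianBasis, ZSpan.mem_fundamentalDomain, Complex.measurableEquivPi, Sigma.forall]
  rw [h, volume_pi, Measure.pi_pi]
  simp_rw [Complex.volume_preserving_equiv_pi.measure_preimage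
    (MeasurableSet.pi Set.countable_univ fun _ _ => measurableSet_Ico).nullMeasurableSet]
  simp [volume_pi, Measure.pi_pi]

theorem exists_gaussianInt_of_mem_span {ι : Type*} [Fintype ι] {x : ι → ℂ}
    (hx : x ∈ Submodule.span ℤ (Set.range (gaussianBasis ι))) :
    ∃ p : ι → GaussianInt, ∀ i, x i = (p i : ℂ) := by
  have h := (gaussianBasis ι).mem_span_iff_repr_mem ℤ x |>.1 hx
  choose m hm using h
  refine ⟨fun i => ⟨m ⟨i, 0⟩, m ⟨i, 1⟩⟩, fun i => ?_⟩
  have h0 := hm ⟨i, 0⟩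
  have h1 := hm ⟨i, 1⟩
  simp only [gaussianBasis, Pi.basis_repr] at h0 h1
  apply Complex.ext
  · simpa using h0.symm
  · simpa using h1.symm

theorem volume_sum_norm_lt_one (k : ℕ) :
    volume {x : Fin k → ℂ | ∑ i, ‖x i‖ < 1} =
      ENNReal.ofReal ((2 * Real.pi) ^ k / (2 * k).factorial) := by
  have h := Complex.volume_sum_rpow_lt_one (Fin k) le_rfl
  have hG : Real.Gamma (2 / 1 + 1) = 2 := by
    have := Real.Gamma_nat_eq_factorial 2
    norm_num at this ⊢
  have hG' : Real.Gamma (2 * (k : ℝ) / 1 + 1) = (2 * k).factorial := by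
    have := Real.Gamma_nat_eq_factorial (2 * k)
    push_cast at this
    simpa using this
  rw [Fintype.card_fin, hG, hG', mul_comm Real.pi] at h
  simpa using h

/-- If no nonzero Gaussian-integer combination of `k` vectors of norm at most one is shorter than
one, then the coefficients of a vector in their span are bounded by its norm. -/
theorem normSq_coeff_le {E : Type*} [SeminormedAddCommGroup E] [NormedSpace ℂ E] {k : ℕ}
    (t : Fin k → E) (ht : ∀ i, ‖t i‖ ≤ 1)
    (hmin : ∀ p : Fin k → GaussianInt, p ≠ 0 → 1 ≤ ‖∑ i, (p i : ℂ) • t i‖)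
    (α : Fin k → ℂ) (hα : ‖∑ i, α i • t i‖ ≤ 1) (j : Fin k) :
    ‖α j‖ ^ 2 ≤ (2 / Real.pi) ^ k * (2 * k).factorial := by
  classical
  -- The identity with column `j` replaced by `α`: it sends `eⱼ` to `α`, and its determinant is `α
  -- j` by Cramer's rule. Over `ℝ` the determinant becomes `‖α j‖ ^ 2`.
  set A : Matrix (Fin k) (Fin k) ℂ := (1 : Matrix (Fin k) (Fin k) ℂ).updateCol j α with hA
  set f : (Fin k → ℂ) →ₗ[ℂ] (Fin k → ℂ) := Matrix.toLin' A with hf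
  set B : Set (Fin k → ℂ) := {β | ‖∑ i, β i • t i‖ < 1} with hB
  have hdet : |(f.restrictScalars ℝ).det| = ‖α j‖ ^ 2 := by
    have : A.det = α j := by
      have h := Matrix.cramer_apply (1 : Matrix (Fin k) (Fin k) ℂ) α j
      rw [Matrix.cramer_one] at h
      simpa [hA] using h.symm
    rw [LinearMap.det_restrictScalars, hf, LinearMap.det_toLin', this, Algebra.norm_complex_apply,
      Complex.normSq_eq_norm_sq, abs_of_nonneg (sq_nonneg _)]
  have hfapp : ∀ β i, f β i = (if i = j then 0 else β i) + β j * α i := by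
    intro β i
    simp only [hf, hA, Matrix.toLin'_apply, Matrix.mulVec, dotProduct, Matrix.updateCol_apply,
      Matrix.one_apply]
    rw [← Finset.add_sum_erase _ _ (Finset.mem_univ j), if_pos rfl, add_comm, mul_comm (α i)]
    congr 1
    rw [Finset.sum_congr rfl (g := fun x => if x = i then β i else 0)]
    · simp [Finset.sum_ite_eq']
    · intro x hx
      rw [if_neg (Finset.ne_of_mem_erase hx)]
      by_cases h : i = x
      · simp [h]
      · simp [h, Ne.symm h]
  -- The images of the basis vectors stand for the `t i` with `i ≠ j` and for `∑ αᵢ tᵢ`, all of norm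
  -- at most one, so the triangle inequality suffices.
  have hsub : f.restrictScalars ℝ '' {x | ∑ i, ‖x i‖ < 1} ⊆ B := by
    rintro _ ⟨β, hβ, rfl⟩
    simp only [Set.mem_ofPred_eq] at hβ
    refine lt_of_le_of_lt ?_ hβ
    have hsum : ∑ i, f.restrictScalars ℝ β i • t i =
        β j • (∑ i, α i • t i) + ∑ i ∈ Finset.univ.erase j, β i • t i := by
      simp only [LinearMap.restrictScalars_apply, hfapp, add_smul, Finset.sum_add_distrib,
        mul_smul, ← Finset.smul_sum]
      rw [add_comm]
      congr 1
      rw [← Finset.add_sum_erase _ _ (Finset.mem_univ j), if_pos rfl, zero_smul, zero_add]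
      exact Finset.sum_congr rfl fun i hi => by rw [if_neg (Finset.ne_of_mem_erase hi)]
    rw [hsum, ← Finset.add_sum_erase _ (fun i => ‖β i‖) (Finset.mem_univ j)]
    refine (norm_add_le _ _).trans (add_le_add ?_ ((norm_sum_le _ _).trans ?_))
    · rw [norm_smul]
      exact mul_le_of_le_one_right (norm_nonneg _) hα
    · refine Finset.sum_le_sum fun i _ => ?_
      rw [norm_smul]
      exact mul_le_of_le_one_right (norm_nonneg _) (ht i)
  -- Minkowski: the Gaussian lattice has covolume one in real dimension `2 * k`, so a larger
  -- symmetric convex set would contain a nonzero lattice point, against `hmin`.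
  have hvol : volume B ≤ 2 ^ (2 * k) := by
    by_contra! hlt
    let Λ := (Submodule.span ℤ (Set.range (gaussianBasis (Fin k)))).toAddSubgroup
    have : Countable Λ :=
      inferInstanceAs (Countable (Submodule.span ℤ (Set.range (gaussianBasis (Fin k)))))
    obtain ⟨x, hx0, hxB⟩ := exists_ne_zero_mem_lattice_of_measure_mul_two_pow_lt_measure
      (μ := volume) (s := B) (ZSpan.isAddFundamentalDomain' (gaussianBasis (Fin k)) volume)
      (fun x hx => by simpa [hB, neg_smul, norm_neg] using hx)
      (by
        intro x hx y hy a b ha hb hab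
        simp only [hB, Set.mem_ofPred_eq] at hx hy ⊢
        have : ∑ i, (a • x + b • y) i • t i =
            (a : ℂ) • ∑ i, x i • t i + (b : ℂ) • ∑ i, y i • t i := by
          simp [add_smul, Finset.sum_add_distrib, Finset.smul_sum, mul_smul]
        rw [this]
        refine (norm_add_le _ _).trans_lt ?_
        rw [norm_smul, norm_smul, Complex.norm_real, Complex.norm_real, Real.norm_of_nonneg ha,
          Real.norm_of_nonneg hb]
        rcases eq_or_lt_of_le ha with rfl | ha'
        · have : b = 1 := by linarith
          subst this
          simpa using hy
        · nlinarith)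
      (by
        rw [volume_fundamentalDomain_gaussianBasis, one_mul]
        convert hlt
        simp [Module.finrank_pi_fintype, Complex.finrank_real_complex, mul_comm])
    obtain ⟨p, hp⟩ := exists_gaussianInt_of_mem_span x.2
    have hp0 : p ≠ 0 := by
      rintro rfl
      exact hx0 (Subtype.ext (funext fun i => by simpa using hp i))
    have := hmin p hp0
    simp only [hB, Set.mem_ofPred_eq, hp] at hxB
    linarith
  have hle := (measure_mono hsub).trans hvol
  rw [Measure.addHaar_image_linearMap, hdet, volume_sum_norm_lt_one,
    ← ENNReal.ofReal_mul (sq_nonneg _),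
    show (2 : ENNReal) ^ (2 * k) = ENNReal.ofReal (2 ^ (2 * k)) by
      rw [ENNReal.ofReal_pow (by norm_num)]; simp,
    ENNReal.ofReal_le_ofReal_iff (by positivity), ← mul_div_assoc,
    div_le_iff₀ (by positivity)] at hle
  have hpi : (0 : ℝ) < (2 * Real.pi) ^ k := by positivity
  rw [← mul_le_mul_iff_left₀ hpi]
  refine hle.trans (le_of_eq ?_)
  have : (2 / Real.pi) ^ k * (2 * Real.pi) ^ k = 2 ^ (2 * k) := by
    rw [← mul_pow, pow_mul]
    congr 1
    field_simp
  rw [← this]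
  ring

end Stabilizer

namespace Stabilizer

/-! ### The Barnes–Wall lattice and its minimum -/

open Matrix Complex

/-- The ring of Gaussian integers as a subring of `ℂ`. -/
noncomputable def gaussianSubring : Subring ℂ := GaussianInt.toComplex.range

theorem I_mem_gaussianSubring : I ∈ gaussianSubring :=
  ⟨⟨0, 1⟩, by simp [GaussianInt.toComplex_def]⟩

theorem one_le_norm_sq_of_mem_gaussianSubring {z : ℂ} (hz : z ∈ gaussianSubring) (h0 : z ≠ 0) :
    1 ≤ ‖z‖ ^ 2 := by
  obtain ⟨p, rfl⟩ := hz
  rw [← Complex.normSq_eq_norm_sq, ← GaussianInt.intCast_real_norm]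
  have : p ≠ 0 := fun h => h0 (by simp [h])
  exact_mod_cast GaussianInt.norm_pos.2 this

theorem norm_one_add_I_sq : ‖1 + I‖ ^ 2 = 2 := by
  rw [← Complex.normSq_eq_norm_sq]
  norm_num [Complex.normSq_apply]

theorem one_add_I_ne_zero : (1 + I : ℂ) ≠ 0 := fun h => by
  have := norm_one_add_I_sq
  simp [h] at this

/-- The one-qubit Barnes–Wall lattice: pairs of Gaussian integers congruent modulo `1 + I`. -/
def IsBarnesWallVector (w : Fin 2 → ℂ) : Prop :=
  w 0 ∈ gaussianSubring ∧ ∃ z ∈ gaussianSubring, w 1 = w 0 + (1 + I) * z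

theorem IsBarnesWallVector.apply_mem {w : Fin 2 → ℂ} (hw : IsBarnesWallVector w) (b : Fin 2) :
    w b ∈ gaussianSubring := by
  obtain ⟨h0, z, hz, h1⟩ := hw
  fin_cases b
  · exact h0
  · change w 1 ∈ _
    rw [h1]
    exact add_mem h0 (mul_mem (add_mem (one_mem _) I_mem_gaussianSubring) hz)

/-- The product vector with tensor factors `w i`. -/
def productVector {n : ℕ} (w : Fin n → Fin 2 → ℂ) : Bits n → ℂ := fun x => ∏ i, w i (x i)

/-- The complex Barnes–Wall lattice: the Gaussian-integer span of the products of vectors in the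
one-qubit lattice. -/
noncomputable def barnesWall (n : ℕ) : Submodule gaussianSubring (Bits n → ℂ) :=
  Submodule.span gaussianSubring
    {f | ∃ w : Fin n → Fin 2 → ℂ, (∀ i, IsBarnesWallVector (w i)) ∧ f = productVector w}

theorem productVector_mem {n : ℕ} {w : Fin n → Fin 2 → ℂ} (hw : ∀ i, IsBarnesWallVector (w i)) :
    productVector w ∈ barnesWall n :=
  Submodule.subset_span ⟨w, hw, rfl⟩

theorem smul_mem_barnesWall {n : ℕ} {z : ℂ} (hz : z ∈ gaussianSubring) {f : Bits n → ℂ}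
    (hf : f ∈ barnesWall n) : z • f ∈ barnesWall n :=
  (barnesWall n).smul_mem ⟨z, hz⟩ hf

/-- The `(u, u + (1 + I) v)` form of the lattice, which makes induction on `n` possible. On a
product vector it comes from splitting off the first factor; it survives linear combinations. -/
theorem exists_halves_of_mem_barnesWall {n : ℕ} {f : Bits (n + 1) → ℂ}
    (hf : f ∈ barnesWall (n + 1)) :
    ∃ u ∈ barnesWall n, ∃ v ∈ barnesWall n,
      ∀ x, f (Fin.cons 0 x) = u x ∧ f (Fin.cons 1 x) = u x + (1 + I) * v x := by
  induction hf using Submodule.span_induction with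
  | mem f hf =>
    obtain ⟨w, hw, rfl⟩ := hf
    obtain ⟨h0, z, hz, h1⟩ := hw 0
    have ht := productVector_mem (w := fun i => w i.succ) fun i => hw i.succ
    refine ⟨_, smul_mem_barnesWall h0 ht, _, smul_mem_barnesWall hz ht, fun x => ⟨?_, ?_⟩⟩
    · simp [productVector, Fin.prod_univ_succ]
    · simp only [productVector, Fin.prod_univ_succ, Fin.cons_zero, Fin.cons_succ, h1,
        Pi.smul_apply, smul_eq_mul]
      ring
  | zero => exact ⟨0, zero_mem _, 0, zero_mem _, fun x => by simp⟩
  | add f g _ _ hf hg =>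
    obtain ⟨u, hu, v, hv, h⟩ := hf
    obtain ⟨u', hu', v', hv', h'⟩ := hg
    refine ⟨u + u', add_mem hu hu', v + v', add_mem hv hv', fun x => ⟨?_, ?_⟩⟩
    · simp [(h x).1, (h' x).1]
    · simp only [Pi.add_apply, (h x).2, (h' x).2]
      ring
  | smul a f _ hf =>
    obtain ⟨u, hu, v, hv, h⟩ := hf
    refine ⟨a • u, (barnesWall n).smul_mem a hu, a • v, (barnesWall n).smul_mem a hv,
      fun x => ⟨?_, ?_⟩⟩
    · simp [(h x).1]
    · simp only [Pi.smul_apply, (h x).2, Subring.smul_def, smul_eq_mul]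
      ring

theorem sum_bits_succ {n : ℕ} (g : Bits (n + 1) → ℝ) :
    ∑ x, g x = ∑ x : Bits n, g (Fin.cons 0 x) + ∑ x : Bits n, g (Fin.cons 1 x) := by
  rw [← (Fin.consEquiv fun _ : Fin (n + 1) => Fin 2).sum_comp, Fintype.sum_prod_type,
    Fin.sum_univ_two]
  rfl

/-- The minimal squared norm of the Barnes–Wall lattice is at least `2 ^ n`. -/
theorem two_pow_le_of_mem_barnesWall {n : ℕ} {f : Bits n → ℂ} (hf : f ∈ barnesWall n)
    (h0 : f ≠ 0) : (2 : ℝ) ^ n ≤ ∑ x, ‖f x‖ ^ 2 := by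
  induction n with
  | zero =>
    have hmem : ∀ x, f x ∈ gaussianSubring := by
      intro x
      -- The hypothesis `h0` is carried through the induction, so vanishing summands are treated
      -- separately.
      induction hf using Submodule.span_induction with
      | mem f hf =>
        obtain ⟨w, hw, rfl⟩ := hf
        exact prod_mem fun i _ => (hw i).apply_mem _
      | zero => exact zero_mem _
      | add f g _ _ hf hg =>
        by_cases h : f = 0
        · by_cases h' : g = 0
          · simp [h, h', zero_mem]
          · simpa [h] using hg h'
        · by_cases h' : g = 0
          · simpa [h'] using hf h
          · exact add_mem (hf h) (hg h')
      | smul a f _ hf =>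
        by_cases h : f = 0
        · simp [h, zero_mem]
        · exact mul_mem a.2 (hf h)
    rw [Fintype.sum_unique, pow_zero]
    refine one_le_norm_sq_of_mem_gaussianSubring (hmem _) fun h => h0 (funext fun x => ?_)
    exact (congrArg f (Subsingleton.elim x _)).trans h
  | succ n ih =>
    obtain ⟨u, hu, v, hv, h⟩ := exists_halves_of_mem_barnesWall hf
    have hs : ∑ x, ‖f x‖ ^ 2 = ∑ x, ‖u x‖ ^ 2 + ∑ x, ‖(u + (1 + I) • v) x‖ ^ 2 := by
      rw [sum_bits_succ]
      simp [(h _).1, (h _).2]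
    have hz : (1 + I : ℂ) ∈ gaussianSubring := add_mem (one_mem _) I_mem_gaussianSubring
    have hv2 : ∑ x, ‖((1 + I) • v) x‖ ^ 2 = 2 * ∑ x, ‖v x‖ ^ 2 := by
      simp only [Pi.smul_apply, norm_smul, mul_pow, norm_one_add_I_sq, Finset.mul_sum]
    have hpos : ∀ g : Bits n → ℂ, 0 ≤ ∑ x, ‖g x‖ ^ 2 := fun g => by positivity
    have hv' : v ≠ 0 → (2 : ℝ) ^ n ≤ ∑ x, ‖v x‖ ^ 2 := ih hv
    rw [hs, pow_succ]
    -- If one half vanishes, the other has squared norm `2 ‖v‖²` with `v ≠ 0`; if neither does, each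
    -- half contributes `2 ^ n`.
    by_cases hu0 : u = 0
    · subst hu0
      have : v ≠ 0 := by
        rintro rfl
        refine h0 (funext fun x => ?_)
        rw [← Fin.cons_self_tail x]
        generalize x 0 = b
        fin_cases b
        · simpa using (h (Fin.tail x)).1
        · simpa using (h (Fin.tail x)).2
      simp only [zero_add, hv2]
      linarith [hv' this, hpos 0]
    · by_cases hw0 : u + (1 + I) • v = 0
      · have hv0 : v ≠ 0 := by
          rintro rfl
          simp [hu0] at hw0
        have : u = -((1 + I) • v) := eq_neg_of_add_eq_zero_left hw0
        have hun : ∑ x, ‖u x‖ ^ 2 = 2 * ∑ x, ‖v x‖ ^ 2 := by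
          rw [← hv2, this]
          simp only [Pi.neg_apply, norm_neg]
        linarith [hv' hv0, hpos (u + (1 + I) • v)]
      · linarith [ih hu hu0, ih (add_mem hu (smul_mem_barnesWall hz hv)) hw0]

theorem mulVec_mem_barnesWall {n : ℕ} {M : Matrix (Bits n) (Bits n) ℂ}
    (hM : ∀ w : Fin n → Fin 2 → ℂ, (∀ i, IsBarnesWallVector (w i)) →
      M *ᵥ productVector w ∈ barnesWall n)
    {f : Bits n → ℂ} (hf : f ∈ barnesWall n) : M *ᵥ f ∈ barnesWall n := by
  induction hf using Submodule.span_induction with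
  | mem f hf =>
    obtain ⟨w, hw, rfl⟩ := hf
    exact hM w hw
  | zero => simp [zero_mem]
  | add f g _ _ hf hg =>
    rw [mulVec_add]
    exact add_mem hf hg
  | smul a f _ hf =>
    rw [mulVec_smul]
    exact (barnesWall n).smul_mem a hf

/-! ### Action of the gates on product vectors and on the lattice -/

theorem onQubit_mulVec {n : ℕ} (U : Matrix (Fin 2) (Fin 2) ℂ) (i : Fin n) (f : Bits n → ℂ)
    (x : Bits n) :
    (onQubit U i *ᵥ f) x = ∑ b, U (x i) b * f (Function.update x i b) := by
  symm
  refine Fintype.sum_of_injective (Function.update x i) (Function.update_injective x i) _ _ ?_ ?_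
  · intro y hy
    have : ¬ ∀ j, j ≠ i → x j = y j := fun h => hy ⟨y i, by
      ext j
      by_cases hj : j = i
      · subst hj; simp
      · simp [hj, h j hj]⟩
    simp only [onQubit, of_apply, if_neg this, zero_mul]
  · intro b
    have : ∀ j, j ≠ i → x j = Function.update x i b j := fun j hj => by simp [hj]
    simp only [onQubit, of_apply, if_pos this, Function.update_self]

theorem onQubit_mul {n : ℕ} (U V : Matrix (Fin 2) (Fin 2) ℂ) (i : Fin n) :
    onQubit (U * V) i = onQubit U i * onQubit V i := by
  refine Matrix.mulVec_injective (funext fun f => funext fun x => ?_)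
  rw [← mulVec_mulVec]
  simp only [onQubit_mulVec, Matrix.mul_apply, Function.update_self, Function.update_idem,
    Finset.sum_mul, Finset.mul_sum, mul_assoc]
  exact Finset.sum_comm

theorem onQubit_one {n : ℕ} (i : Fin n) : onQubit 1 i = 1 := by
  refine Matrix.mulVec_injective (funext fun f => funext fun x => ?_)
  simp [onQubit_mulVec, Matrix.one_apply]

theorem onQubit_smul {n : ℕ} (c : ℂ) (U : Matrix (Fin 2) (Fin 2) ℂ) (i : Fin n) :
    onQubit (c • U) i = c • onQubit U i := by
  ext x y
  simp [onQubit]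

theorem onQubit_conjTranspose {n : ℕ} (U : Matrix (Fin 2) (Fin 2) ℂ) (i : Fin n) :
    (onQubit U i)ᴴ = onQubit Uᴴ i := by
  ext x y
  simp only [onQubit, conjTranspose_apply, of_apply]
  by_cases h : ∀ j, j ≠ i → x j = y j
  · rw [if_pos h, if_pos fun j hj => (h j hj).symm]
  · rw [if_neg h, if_neg fun h' => h fun j hj => (h' j hj).symm, star_zero]

theorem onQubit_mulVec_productVector {n : ℕ} (U : Matrix (Fin 2) (Fin 2) ℂ) (i : Fin n)
    (w : Fin n → Fin 2 → ℂ) :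
    onQubit U i *ᵥ productVector w = productVector (Function.update w i (U *ᵥ w i)) := by
  ext x
  rw [onQubit_mulVec]
  simp only [productVector]
  rw [← Finset.mul_prod_erase _ _ (Finset.mem_univ i), Function.update_self]
  simp only [mulVec, dotProduct, Finset.sum_mul]
  refine Finset.sum_congr rfl fun b _ => ?_
  rw [← Finset.mul_prod_erase _ _ (Finset.mem_univ i), Function.update_self, mul_assoc]
  congr 2
  refine Finset.prod_congr rfl fun j hj => ?_
  simp [Finset.ne_of_mem_erase hj]

theorem onQubit_mulVec_mem_barnesWall {n : ℕ} {U : Matrix (Fin 2) (Fin 2) ℂ}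
    (hU : ∀ w, IsBarnesWallVector w → IsBarnesWallVector (U *ᵥ w)) (i : Fin n)
    {f : Bits n → ℂ} (hf : f ∈ barnesWall n) : onQubit U i *ᵥ f ∈ barnesWall n := by
  refine mulVec_mem_barnesWall (fun w hw => ?_) hf
  rw [onQubit_mulVec_productVector]
  refine productVector_mem fun j => ?_
  by_cases hj : j = i
  · subst hj
    simpa using hU _ (hw j)
  · simpa [hj] using hw j

theorem bits_cx_involutive {n : ℕ} {i j : Fin n} (hij : i ≠ j) :
    Function.Involutive fun x : Bits n => Function.update x j (x i + x j) := by
  intro x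
  ext l
  by_cases hl : l = j
  · subst hl
    simp only [Function.update_self, Function.update_of_ne hij]
    generalize x i = a
    generalize x l = b
    revert a b
    decide
  · simp [hl]

theorem gateCX_mulVec {n : ℕ} {i j : Fin n} (hij : i ≠ j) (f : Bits n → ℂ) :
    gateCX i j *ᵥ f = fun x => f (Function.update x j (x i + x j)) := by
  ext x
  have h : ∀ y : Bits n, x = Function.update y j (y i + y j) ↔
      y = Function.update x j (x i + x j) := fun y =>
    (bits_cx_involutive hij).eq_iff.symm.trans eq_comm
  simp [gateCX, mulVec, dotProduct, h]

theorem gateCX_conjTranspose {n : ℕ} {i j : Fin n} (hij : i ≠ j) :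
    (gateCX i j)ᴴ = gateCX i j := by
  ext x y
  have h : x = Function.update y j (y i + y j) ↔ y = Function.update x j (x i + x j) :=
    (bits_cx_involutive hij).eq_iff.symm.trans eq_comm
  simp only [gateCX, conjTranspose_apply, of_apply, h]
  split_ifs <;> simp

/-- On a product vector, the gate changes only the part with control bit one, where swapping the
entries of `w j` adds `(1 + I) * z` times `(1, -1)`. Moving the factor `1 + I` to the control makes
the correction a product of one-qubit lattice vectors. -/
theorem gateCX_mulVec_mem_barnesWall {n : ℕ} {i j : Fin n} (hij : i ≠ j) {f : Bits n → ℂ}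
    (hf : f ∈ barnesWall n) : gateCX i j *ᵥ f ∈ barnesWall n := by
  refine mulVec_mem_barnesWall (fun w hw => ?_) hf
  rw [gateCX_mulVec hij]
  obtain ⟨-, z, hz, h1⟩ := hw j
  have hmem : productVector w +
      productVector (Function.update (Function.update w i ![0, (1 + I) * w i 1]) j ![z, -z]) ∈
        barnesWall n := by
    refine add_mem (productVector_mem hw) (productVector_mem fun l => ?_)
    by_cases hl : l = j
    · subst hl
      rw [Function.update_self]
      exact ⟨hz, -((1 - I) * z),
        neg_mem (mul_mem (sub_mem (one_mem _) I_mem_gaussianSubring) hz), by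
          simp only [cons_val_zero, cons_val_one]
          linear_combination -z * I_sq⟩
    · rw [Function.update_of_ne hl]
      by_cases hl' : l = i
      · subst hl'
        rw [Function.update_self]
        exact ⟨zero_mem _, w l 1, (hw l).apply_mem 1, by simp⟩
      · rw [Function.update_of_ne hl']
        exact hw l
  convert hmem using 1
  ext x
  simp only [productVector, Pi.add_apply]
  have hj : j ∈ Finset.univ.erase i := Finset.mem_erase.2 ⟨hij.symm, Finset.mem_univ j⟩
  simp only [← Finset.mul_prod_erase _ _ (Finset.mem_univ i), ← Finset.mul_prod_erase _ _ hj]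
  have hP : ∀ g : Fin n → ℂ, (∀ l, l ≠ i → l ≠ j → g l = w l (x l)) →
      ∏ l ∈ (Finset.univ.erase i).erase j, g l =
        ∏ l ∈ (Finset.univ.erase i).erase j, w l (x l) := fun g hg =>
    Finset.prod_congr rfl fun l hl => hg l
      (Finset.ne_of_mem_erase (Finset.mem_of_mem_erase hl)) (Finset.ne_of_mem_erase hl)
  rw [hP (fun l => w l (Function.update x j (x i + x j) l)) fun l _ h => by simp [h],
    hP (fun l => Function.update (Function.update w i ![0, (1 + I) * w i 1]) j ![z, -z] l (x l))
      fun l h h' => by simp [h, h']]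
  simp only [Function.update_self, Function.update_of_ne hij]
  generalize ∏ l ∈ (Finset.univ.erase i).erase j, w l (x l) = P
  generalize x i = a
  generalize x j = b
  fin_cases a <;> fin_cases b
  · simp
  · simp
  · simp [h1]
    ring
  · simp [h1]
    ring

end Stabilizer

namespace Stabilizer

/-! ### Clifford unitaries and stabilizer states -/

open Matrix Complex

theorem gateS_mem_unitaryGroup : gateS ∈ unitaryGroup (Fin 2) ℂ := by
  rw [mem_unitaryGroup_iff]
  ext a b
  fin_cases a <;> fin_cases b <;> simp [gateS, Matrix.mul_apply, star_eq_conjTranspose]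

theorem inv_sqrt_two_mul_self :
    ((1 / Real.sqrt 2 : ℝ) : ℂ) * ((1 / Real.sqrt 2 : ℝ) : ℂ) = 1 / 2 := by
  rw [← ofReal_mul, div_mul_div_comm, Real.mul_self_sqrt (by norm_num)]
  norm_num

theorem gateH_conjTranspose : gateHᴴ = gateH := by
  ext a b
  fin_cases a <;> fin_cases b <;> simp [gateH]

theorem gateH_mem_unitaryGroup : gateH ∈ unitaryGroup (Fin 2) ℂ := by
  rw [mem_unitaryGroup_iff, star_eq_conjTranspose, gateH_conjTranspose]
  simp only [gateH, smul_mul_smul_comm, inv_sqrt_two_mul_self]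
  ext a b
  fin_cases a <;> fin_cases b <;> norm_num [Matrix.mul_apply, Fin.sum_univ_two]

/-- The product `H S S H` is the bit-flip gate. -/
theorem gateH_mul_gateS_sq_mul_gateH :
    gateH * gateS * gateS * gateH = !![0, 1; 1, 0] := by
  have h : gateS * gateS = !![1, 0; 0, -1] := by
    ext a b
    fin_cases a <;> fin_cases b <;> simp [gateS, Matrix.mul_apply]
  rw [mul_assoc gateH, h]
  simp only [gateH, smul_mul_assoc, mul_smul_comm, smul_smul, inv_sqrt_two_mul_self]
  ext a b
  fin_cases a <;> fin_cases b <;> norm_num [Matrix.mul_apply, Fin.sum_univ_two]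

theorem onQubit_mem_unitaryGroup {n : ℕ} {U : Matrix (Fin 2) (Fin 2) ℂ}
    (hU : U ∈ unitaryGroup (Fin 2) ℂ) (i : Fin n) : onQubit U i ∈ unitaryGroup (Bits n) ℂ := by
  rw [mem_unitaryGroup_iff, star_eq_conjTranspose] at *
  rw [onQubit_conjTranspose, ← onQubit_mul, hU, onQubit_one]

theorem isBarnesWallVector_gateS {w : Fin 2 → ℂ} (hw : IsBarnesWallVector w) :
    IsBarnesWallVector (gateS *ᵥ w) := by
  obtain ⟨h0, z, hz, h1⟩ := hw
  refine ⟨by simpa [gateS, mulVec, dotProduct] using h0, I * w 0 + I * z,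
    add_mem (mul_mem I_mem_gaussianSubring h0) (mul_mem I_mem_gaussianSubring hz), ?_⟩
  simp [gateS, mulVec, dotProduct, h1]
  linear_combination (-w 0) * I_sq

theorem isBarnesWallVector_gateS_conjTranspose {w : Fin 2 → ℂ} (hw : IsBarnesWallVector w) :
    IsBarnesWallVector (gateSᴴ *ᵥ w) := by
  obtain ⟨h0, z, hz, h1⟩ := hw
  refine ⟨by simpa [gateS, mulVec, dotProduct] using h0, -w 0 - I * z,
    sub_mem (neg_mem h0) (mul_mem I_mem_gaussianSubring hz), ?_⟩
  simp [gateS, mulVec, dotProduct, h1]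
  ring

/-- Dividing by `1 + I` instead of `√2` changes the gate by a phase only. The entries `2 * w 0 + (1
+ I) * z` and `-(1 + I) * z` are divisible by `1 + I` because `2 = (1 + I) * (1 - I)`. -/
theorem isBarnesWallVector_hadamard {w : Fin 2 → ℂ} (hw : IsBarnesWallVector w) :
    IsBarnesWallVector (((1 + I)⁻¹ : ℂ) • (!![1, 1; 1, -1] : Matrix _ _ ℂ) *ᵥ w) := by
  obtain ⟨h0, z, hz, h1⟩ := hw
  have hI := sub_mem (one_mem _) I_mem_gaussianSubring
  have e0 : (((1 + I)⁻¹ : ℂ) • (!![1, 1; 1, -1] : Matrix _ _ ℂ) *ᵥ w) 0 = (1 - I) * w 0 + z := by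
    simp [dotProduct, h1]
    rw [inv_mul_eq_iff_eq_mul₀ one_add_I_ne_zero]
    linear_combination w 0 * I_sq
  have e1 : (((1 + I)⁻¹ : ℂ) • (!![1, 1; 1, -1] : Matrix _ _ ℂ) *ᵥ w) 1 = - z := by
    simp [dotProduct, h1]
    rw [inv_mul_eq_iff_eq_mul₀ one_add_I_ne_zero]
  refine ⟨?_, I * w 0 - (1 - I) * z, ?_, ?_⟩
  · rw [e0]
    exact add_mem (mul_mem hI h0) hz
  · exact sub_mem (mul_mem I_mem_gaussianSubring h0) (mul_mem hI hz)
  · rw [e0, e1]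
    linear_combination (-w 0 - z) * I_sq

theorem IsBarnesWallVector.smul {c : ℂ} (hc : c ∈ gaussianSubring) {w : Fin 2 → ℂ}
    (hw : IsBarnesWallVector w) : IsBarnesWallVector (c • w) := by
  obtain ⟨h0, z, hz, h1⟩ := hw
  refine ⟨mul_mem hc h0, c * z, mul_mem hc hz, ?_⟩
  simp only [Pi.smul_apply, h1, smul_eq_mul]
  ring

/-- The inverse Hadamard gate with the inverse phase; `(1 + I) / 2` is the unit `I` times `(1 +
I)⁻¹`. -/
theorem isBarnesWallVector_hadamard' {w : Fin 2 → ℂ} (hw : IsBarnesWallVector w) :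
    IsBarnesWallVector (((1 + I) / 2 : ℂ) • (!![1, 1; 1, -1] : Matrix _ _ ℂ) *ᵥ w) := by
  have h := isBarnesWallVector_hadamard hw
  have hI : ((1 + I) / 2 : ℂ) = I * (1 + I)⁻¹ := by
    rw [eq_mul_inv_iff_mul_eq₀ one_add_I_ne_zero]
    linear_combination I_sq / 2
  rw [hI, mul_smul]
  exact h.smul I_mem_gaussianSubring

/-- Up to a phase, Clifford unitaries preserve the Barnes–Wall lattice. -/
theorem exists_phase_of_mem_cliffordGroup {n : ℕ} {C : unitaryGroup (Bits n) ℂ}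
    (hC : C ∈ cliffordGroup n) :
    ∃ c : ℂ, ‖c‖ = 1 ∧
      (∀ f ∈ barnesWall n, c • ((C : Matrix (Bits n) (Bits n) ℂ) *ᵥ f) ∈ barnesWall n) ∧
      ∀ f ∈ barnesWall n,
        c⁻¹ • (((C⁻¹ : unitaryGroup (Bits n) ℂ) : Matrix (Bits n) (Bits n) ℂ) *ᵥ f) ∈
          barnesWall n := by
  have hinv : ∀ U : unitaryGroup (Bits n) ℂ,
      ((U⁻¹ : unitaryGroup (Bits n) ℂ) : Matrix (Bits n) (Bits n) ℂ) =
        (U : Matrix (Bits n) (Bits n) ℂ)ᴴ := fun U => rfl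
  -- Since the claim treats `C` and `C⁻¹` together, the inverse case merely exchanges its two
  -- halves.
  induction hC using Subgroup.closure_induction with
  | mem U hU =>
    rw [hinv]
    rcases hU with ⟨i, hU⟩ | ⟨i, hU⟩ | ⟨i, j, hij, hU⟩ <;> rw [hU]
    · refine ⟨1, norm_one, fun f hf => ?_, fun f hf => ?_⟩
      · rw [one_smul]
        exact onQubit_mulVec_mem_barnesWall (fun w => isBarnesWallVector_gateS) i hf
      · rw [inv_one, one_smul, onQubit_conjTranspose]
        exact onQubit_mulVec_mem_barnesWall (fun w => isBarnesWallVector_gateS_conjTranspose) i hf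
    · have hs : ((Real.sqrt 2 : ℝ) : ℂ) * (Real.sqrt 2 : ℝ) = 2 := by
        rw [← ofReal_mul, Real.mul_self_sqrt (by norm_num)]
        norm_num
      have hs0 : ((Real.sqrt 2 : ℝ) : ℂ) ≠ 0 := fun h => by simp [h] at hs
      refine ⟨(Real.sqrt 2 : ℝ) / (1 + I), ?_, fun f hf => ?_, fun f hf => ?_⟩
      · rw [norm_div, norm_real, Real.norm_of_nonneg (Real.sqrt_nonneg _), ← norm_one_add_I_sq,
          Real.sqrt_sq (norm_nonneg _), div_self (norm_ne_zero_iff.2 one_add_I_ne_zero)]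
      · rw [← smul_mulVec, ← onQubit_smul]
        refine onQubit_mulVec_mem_barnesWall (fun w hw => ?_) i hf
        convert isBarnesWallVector_hadamard hw using 1
        rw [gateH, smul_smul, smul_mulVec]
        congr 1
        push_cast
        have := one_add_I_ne_zero
        field_simp
      · rw [← smul_mulVec, onQubit_conjTranspose, gateH_conjTranspose, ← onQubit_smul]
        refine onQubit_mulVec_mem_barnesWall (fun w hw => ?_) i hf
        convert isBarnesWallVector_hadamard' hw using 1
        rw [gateH, smul_smul, smul_mulVec]
        congr 1
        push_cast
        rw [inv_div, div_mul_div_comm, hs, mul_one]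
    · refine ⟨1, norm_one, fun f hf => ?_, fun f hf => ?_⟩
      · rw [one_smul]
        exact gateCX_mulVec_mem_barnesWall hij hf
      · rw [inv_one, one_smul, gateCX_conjTranspose hij]
        exact gateCX_mulVec_mem_barnesWall hij hf
  | one => exact ⟨1, norm_one, fun f hf => by simpa, fun f hf => by simpa⟩
  | mul U V _ _ hU hV =>
    obtain ⟨c, hc, h1, h2⟩ := hU
    obtain ⟨d, hd, h1', h2'⟩ := hV
    refine ⟨c * d, by simp [hc, hd], fun f hf => ?_, fun f hf => ?_⟩
    · have := h1 _ (h1' f hf)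
      rwa [mulVec_smul, smul_smul, mulVec_mulVec] at this
    · have := h2' _ (h2 f hf)
      rw [mulVec_smul, smul_smul, mulVec_mulVec] at this
      rwa [_root_.mul_inv_rev U V, mul_inv, mul_comm c⁻¹]
  | inv U _ hU =>
    obtain ⟨c, hc, h1, h2⟩ := hU
    exact ⟨c⁻¹, by simp [hc], h2, by simpa using h1⟩

/-- The vector `(1 + I) ^ n |0ⁿ⟩` is the product of copies of the lattice vector `(1 + I, 0)`, and
the Clifford unitary preserves the lattice up to phase. -/
theorem IsStabilizerState.exists_smul_mem_barnesWall {n : ℕ} {s : Qubits n}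
    (hs : IsStabilizerState s) :
    ∃ c : ℂ, ‖c‖ ^ 2 = 2 ^ n ∧ c • s.ofLp ∈ barnesWall n := by
  obtain ⟨C, hC, rfl⟩ := hs
  obtain ⟨c, hc, h, -⟩ := exists_phase_of_mem_cliffordGroup hC
  have h0 : (1 + I) ^ n • (zeroState n).ofLp ∈ barnesWall n := by
    convert productVector_mem (n := n) (w := fun _ => ![1 + I, 0]) fun i =>
      ⟨add_mem (one_mem _) I_mem_gaussianSubring, -1, neg_mem (one_mem _), by simp⟩ using 1
    ext x
    by_cases hx : x = 0
    · subst hx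
      simp [zeroState, productVector]
    · obtain ⟨i, hi⟩ := Function.ne_iff.1 hx
      have hi1 : x i = 1 := by
        revert hi
        generalize x i = b
        fin_cases b <;> simp
      simp only [zeroState, productVector, Pi.smul_apply]
      rw [Finset.prod_eq_zero (Finset.mem_univ i) (by simp [hi1])]
      simp [hx]
  refine ⟨c * (1 + I) ^ n, ?_, ?_⟩
  · rw [norm_mul, hc, one_mul, norm_pow, ← pow_mul, mul_comm, pow_mul, norm_one_add_I_sq]
  · have := h _ h0
    rwa [mulVec_smul, smul_smul] at this

theorem IsStabilizerState.norm_eq_one {n : ℕ} {s : Qubits n} (hs : IsStabilizerState s) :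
    ‖s‖ = 1 := by
  obtain ⟨C, -, rfl⟩ := hs
  have h := C.2
  rw [mem_unitaryGroup_iff', star_eq_conjTranspose] at h
  have hsq : ((‖WithLp.toLp 2 ((C : Matrix (Bits n) (Bits n) ℂ) *ᵥ (zeroState n).ofLp)‖ : ℝ) : ℂ)
      ^ 2 = 1 := by
    refine (inner_self_eq_norm_sq_to_K (𝕜 := ℂ) (E := Qubits n) _).symm.trans ?_
    rw [EuclideanSpace.inner_eq_star_dotProduct, dotProduct_comm, star_mulVec, dotProduct_mulVec, vecMul_vecMul, h, vecMul_one]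
    simp [zeroState]
  have : ‖WithLp.toLp 2 ((C : Matrix (Bits n) (Bits n) ℂ) *ᵥ (zeroState n).ofLp)‖ ^ 2 = 1 := by
    exact_mod_cast hsq
  exact (pow_eq_one_iff_of_nonneg (norm_nonneg _) two_ne_zero).1 this

theorem onQubit_flip_mulVec_single {n : ℕ} (i : Fin n) (y : Bits n) :
    onQubit !![0, 1; 1, 0] i *ᵥ Pi.single y 1 =
      (Pi.single (Function.update y i (y i + 1)) 1 : Bits n → ℂ) := by
  ext x
  rw [mulVec_single_one, col_apply, Pi.single_apply]
  have h : x = Function.update y i (y i + 1) ↔ (∀ j, j ≠ i → x j = y j) ∧ x i = y i + 1 := by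
    rw [Function.eq_update_iff, and_comm]
  simp only [onQubit, of_apply, h, ite_and]
  refine if_congr Iff.rfl ?_ rfl
  generalize x i = a
  generalize y i = b
  fin_cases a <;> fin_cases b <;> simp

theorem exists_flip_mem_cliffordGroup {n : ℕ} (i : Fin n) :
    ∃ g ∈ cliffordGroup n,
      (g : Matrix (Bits n) (Bits n) ℂ) = onQubit !![0, 1; 1, 0] i := by
  let gS : unitaryGroup (Bits n) ℂ := ⟨_, onQubit_mem_unitaryGroup gateS_mem_unitaryGroup i⟩
  let gH : unitaryGroup (Bits n) ℂ := ⟨_, onQubit_mem_unitaryGroup gateH_mem_unitaryGroup i⟩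
  have hS : gS ∈ cliffordGroup n := Subgroup.subset_closure (Or.inl ⟨i, rfl⟩)
  have hH : gH ∈ cliffordGroup n := Subgroup.subset_closure (Or.inr (Or.inl ⟨i, rfl⟩))
  refine ⟨gH * gS * gS * gH, mul_mem (mul_mem (mul_mem hH hS) hS) hH, ?_⟩
  rw [← gateH_mul_gateS_sq_mul_gateH, onQubit_mul, onQubit_mul, onQubit_mul]
  rfl

/-- Bit flips turn on the ones of `x` one at a time. This gives positive fidelity and the existence
of decompositions. -/
theorem isStabilizerState_single {n : ℕ} (x : Bits n) :
    IsStabilizerState (EuclideanSpace.single x (1 : ℂ)) := by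
  have key : ∀ S : Finset (Fin n),
      IsStabilizerState (EuclideanSpace.single (fun i => if i ∈ S then 1 else 0 : Bits n)
        (1 : ℂ)) := by
    intro S
    induction S using Finset.induction_on with
    | empty =>
      refine ⟨1, one_mem _, ?_⟩
      simp only [Finset.notMem_empty, if_false, OneMemClass.coe_one, one_mulVec]
      rfl
    | insert i S hi ih =>
      obtain ⟨C, hC, h⟩ := ih
      obtain ⟨g, hg, hgX⟩ := exists_flip_mem_cliffordGroup i
      refine ⟨g * C, mul_mem hg hC, ?_⟩
      have h' := congrArg WithLp.ofLp h
      simp only [PiLp.ofLp_single] at h'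
      rw [Submonoid.coe_mul, ← mulVec_mulVec, ← h', hgX, onQubit_flip_mulVec_single]
      congr 1
      ext j
      by_cases hj : j = i
      · subst hj; simp [hi]
      · simp [hj]
  convert key (Finset.univ.filter fun i => x i = 1) using 2
  ext i
  simp only [Finset.mem_filter, Finset.mem_univ, true_and]
  generalize x i = b
  fin_cases b <;> simp

end Stabilizer

namespace Stabilizer

/-! ### Coefficients of shortest decompositions -/

open Complex

theorem IsStabilizerState.norm_inner_sq_le {n : ℕ} {s φ : Qubits n} (hs : IsStabilizerState s) :
    ‖inner ℂ s φ‖ ^ 2 ≤ stabilizerFidelity φ := by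
  -- Boundedness, by Cauchy–Schwarz, is what keeps `sSup` from taking its default value.
  refine le_csSup ⟨‖φ‖ ^ 2, ?_⟩ ⟨s, hs, rfl⟩
  rintro _ ⟨s, hs, rfl⟩
  refine pow_le_pow_left₀ (norm_nonneg _) ?_ 2
  simpa [hs.norm_eq_one] using norm_inner_le_norm (𝕜 := ℂ) s φ

theorem stabilizerFidelity_pos {n : ℕ} {φ : Qubits n} (hφ : φ ≠ 0) :
    0 < stabilizerFidelity φ := by
  obtain ⟨x, hx⟩ : ∃ x, φ x ≠ 0 := by
    by_contra! h
    exact hφ (PiLp.ext h)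
  refine lt_of_lt_of_le ?_ (isStabilizerState_single x).norm_inner_sq_le
  rw [EuclideanSpace.inner_single_left, map_one, one_mul]
  exact pow_pos (norm_pos_iff.2 hx) 2

/-- The expansion in the computational basis shows that the set of lengths is nonempty, so `sInf` is
attained and is not the default value `0`. -/
theorem exists_stabilizer_decomposition {n : ℕ} (ψ : Qubits n) :
    ∃ (α : Fin (stabilizerRank ψ) → ℂ) (s : Fin (stabilizerRank ψ) → Qubits n),
      (∀ i, IsStabilizerState (s i)) ∧ ψ = ∑ i, α i • s i := by
  refine Nat.sInf_mem (s := {k : ℕ | ∃ (α : Fin k → ℂ) (s : Fin k → Qubits n),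
    (∀ i, IsStabilizerState (s i)) ∧ ψ = ∑ i, α i • s i}) ?_
  let e := Fintype.equivFin (Bits n)
  refine ⟨Fintype.card (Bits n), fun i => ψ (e.symm i),
    fun i => EuclideanSpace.single (e.symm i) 1, fun i => isStabilizerState_single _, ?_⟩
  rw [e.symm.sum_comp fun x => ψ x • (EuclideanSpace.single x (1 : ℂ) : Qubits n)]
  ext y
  simp [Pi.single_apply]

theorem stabilizerRank_le {n k : ℕ} {ψ : Qubits n} (α : Fin k → ℂ) (s : Fin k → Qubits n)
    (hs : ∀ i, IsStabilizerState (s i)) (h : ψ = ∑ i, α i • s i) : stabilizerRank ψ ≤ k :=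
  Nat.sInf_le ⟨α, s, hs, h⟩

/-- The stabilizer states of a shortest decomposition are linearly independent. -/
theorem eq_zero_of_sum_smul_eq_zero {n k : ℕ} {ψ : Qubits n} (hk : k ≤ stabilizerRank ψ)
    {α : Fin k → ℂ} {s : Fin k → Qubits n} (hs : ∀ i, IsStabilizerState (s i))
    (h : ψ = ∑ i, α i • s i) {β : Fin k → ℂ} (hβ : ∑ i, β i • s i = 0) : β = 0 := by
  by_contra hne
  obtain ⟨j, hj⟩ := Function.ne_iff.1 hne
  rw [Pi.zero_apply] at hj
  obtain _ | m := k
  · exact j.elim0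
  -- Subtracting `α j / β j` times the relation removes the `j`-th term.
  have hle : stabilizerRank ψ ≤ m := by
    refine stabilizerRank_le (fun i => α (j.succAbove i) - α j / β j * β (j.succAbove i))
      (fun i => s (j.succAbove i)) (fun i => hs _) ?_
    have hsum : ψ = ∑ i, (α i - α j / β j * β i) • s i := by
      simp only [sub_smul, Finset.sum_sub_distrib, mul_smul, ← Finset.smul_sum, hβ, smul_zero,
        sub_zero]
      exact h
    rw [hsum, Fin.sum_univ_succAbove _ j, div_mul_cancel₀ _ hj, sub_self, zero_smul, zero_add]
  omega

theorem exists_decomposition_coeff_le {n : ℕ} {ψ : Qubits n} (hψ : ‖ψ‖ = 1) :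
    ∃ (α : Fin (stabilizerRank ψ) → ℂ) (s : Fin (stabilizerRank ψ) → Qubits n),
      (∀ i, IsStabilizerState (s i)) ∧ ψ = ∑ i, α i • s i ∧
      ∀ i, ‖α i‖ ^ 2 ≤
        (2 / Real.pi) ^ stabilizerRank ψ * (2 * stabilizerRank ψ).factorial := by
  obtain ⟨α, s, hs, hψs⟩ := exists_stabilizer_decomposition ψ
  refine ⟨α, s, hs, hψs, fun j => ?_⟩
  choose c hc hcs using fun i => (hs i).exists_smul_mem_barnesWall
  set r : ℝ := Real.sqrt (2 ^ n) with hr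
  have hr0 : 0 < r := Real.sqrt_pos.2 (by positivity)
  have hr2 : r ^ 2 = 2 ^ n := Real.sq_sqrt (by positivity)
  have hrC : (r : ℂ) ≠ 0 := ofReal_ne_zero.2 hr0.ne'
  have hcr : ∀ i, ‖c i‖ = r := fun i => by
    rw [hr, ← hc i, Real.sqrt_sq (norm_nonneg _)]
  have hc0 : ∀ i, c i ≠ 0 := fun i => norm_ne_zero_iff.1 (by rw [hcr]; exact hr0.ne')
  have hnorm : ‖α j‖ = ‖α j * r / c j‖ := by
    rw [norm_div, norm_mul, hcr, norm_real, Real.norm_of_nonneg hr0.le, mul_div_assoc,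
      div_self hr0.ne', mul_one]
  rw [hnorm]
  -- The unit vectors `(c i / r) • s i` are lattice vectors divided by `r = 2 ^ (n / 2)`, so the
  -- lattice minimum gives norm at least one. The rephasing leaves `‖α j‖` unchanged.
  refine normSq_coeff_le (fun i => (c i / r) • s i) (fun i => ?_) (fun p hp => ?_)
    (fun i => α i * r / c i) ?_ j
  · rw [norm_smul, (hs i).norm_eq_one, norm_div, hcr, norm_real, Real.norm_of_nonneg hr0.le,
      div_self hr0.ne', mul_one]
  · have hsum : ∑ i, (p i : ℂ) • (c i / r) • s i =
        (r : ℂ)⁻¹ • ∑ i, ((p i : ℂ) * c i) • s i := by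
      rw [Finset.smul_sum]
      refine Finset.sum_congr rfl fun i _ => ?_
      rw [smul_smul, smul_smul]
      congr 1
      ring
    set v : Qubits n := ∑ i, ((p i : ℂ) * c i) • s i with hv
    have hvmem : v.ofLp ∈ barnesWall n := by
      have : v.ofLp = ∑ i, (p i : ℂ) • c i • (s i).ofLp := by
        rw [hv, WithLp.ofLp_sum]
        exact Finset.sum_congr rfl fun i _ => by rw [WithLp.ofLp_smul, mul_smul]
      rw [this]
      exact sum_mem fun i _ => smul_mem_barnesWall ⟨p i, rfl⟩ (hcs i)
    have hv0 : v.ofLp ≠ 0 := by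
      intro h0
      have h0' : v = 0 := PiLp.ext fun x => congrFun h0 x
      have := eq_zero_of_sum_smul_eq_zero le_rfl hs hψs h0'
      refine hp (funext fun i => ?_)
      have hi := congrFun this i
      simpa [hc0 i] using hi
    have hle := two_pow_le_of_mem_barnesWall hvmem hv0
    rw [← EuclideanSpace.norm_sq_eq, ← hr2] at hle
    have hle' : r ≤ ‖v‖ := (pow_le_pow_iff_left₀ hr0.le (norm_nonneg _) two_ne_zero).1 hle
    rw [hsum, norm_smul, norm_inv, norm_real, Real.norm_of_nonneg hr0.le, inv_mul_eq_div,
      le_div_iff₀ hr0, one_mul]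
    exact hle'
  · refine le_of_eq ?_
    rw [← hψ]
    congr 1
    conv_rhs => rw [hψs]
    refine Finset.sum_congr rfl fun i _ => ?_
    rw [smul_smul]
    congr 1
    have := hc0 i
    field_simp

/-! ### Numerical estimates and the two conclusions -/

/-- Bernoulli's inequality gives `k ≤ 2 * (3 / 2) ^ k`, and `π > 3`, so `k * (2 / π) ^ k ≤ 2`; the
crude `(2k)! ≤ (2k) ^ (2k)` does the rest. The factor `e` is slack. -/
theorem sq_mul_factorial_bound (k : ℕ) :
    (k : ℝ) ^ 2 * ((2 / Real.pi) ^ k * (2 * k).factorial) ≤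
      Real.exp 1 * (2 * (k : ℝ)) ^ (2 * k + 1) := by
  have hb : (k : ℝ) * (2 / Real.pi) ^ k ≤ 2 := by
    have h1 : 1 + (k : ℝ) * (1 / 2) ≤ (1 + 1 / 2) ^ k :=
      one_add_mul_le_pow (by norm_num) k
    have h2 : (2 / Real.pi) ^ k ≤ (2 / 3) ^ k := by
      gcongr
      exact Real.pi_gt_three.le
    have h3 : ((1 : ℝ) + 1 / 2) ^ k * (2 / 3) ^ k = 1 := by
      rw [← mul_pow]
      norm_num
    have h4 : (0 : ℝ) < (2 / 3) ^ k := by positivity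
    calc (k : ℝ) * (2 / Real.pi) ^ k ≤ (2 * (1 + 1 / 2) ^ k) * (2 / 3) ^ k := by
          gcongr
          linarith
      _ = 2 := by rw [mul_assoc, h3, mul_one]
  have hf : ((2 * k).factorial : ℝ) ≤ (2 * (k : ℝ)) ^ (2 * k) := by
    exact_mod_cast Nat.factorial_le_pow (2 * k)
  have he : (1 : ℝ) ≤ Real.exp 1 := Real.one_le_exp zero_le_one
  calc (k : ℝ) ^ 2 * ((2 / Real.pi) ^ k * (2 * k).factorial)
      = (k : ℝ) * (2 / Real.pi) ^ k * (k * (2 * k).factorial) := by ring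
    _ ≤ 2 * (k * (2 * (k : ℝ)) ^ (2 * k)) := by gcongr
    _ = 1 * (2 * (k : ℝ)) ^ (2 * k + 1) := by ring
    _ ≤ Real.exp 1 * (2 * (k : ℝ)) ^ (2 * k + 1) := by gcongr

theorem norm_inner_div_sqrt_fidelity_le {n : ℕ} {φ ψ : Qubits n} (hφ : φ ≠ 0) (hψ : ‖ψ‖ = 1) :
    ‖inner ℂ φ ψ‖ / Real.sqrt (stabilizerFidelity φ) ≤
      Real.sqrt (Real.exp 1) * (2 * (stabilizerRank ψ : ℝ)) ^
        ((2 * (stabilizerRank ψ : ℝ) + 1) / 2) := by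
  obtain ⟨α, s, hs, hψs, hα⟩ := exists_decomposition_coeff_le hψ
  have hb := sq_mul_factorial_bound (stabilizerRank ψ)
  generalize stabilizerRank ψ = k at *
  set M : ℝ := (2 / Real.pi) ^ k * (2 * k).factorial with hM
  have hM0 : 0 ≤ M := by positivity
  rw [div_le_iff₀ (Real.sqrt_pos.2 (stabilizerFidelity_pos hφ))]
  have h1 : ‖inner ℂ φ ψ‖ ≤ k * Real.sqrt M * Real.sqrt (stabilizerFidelity φ) := by
    rw [hψs, inner_sum]
    refine (norm_sum_le _ _).trans ?_
    refine (Finset.sum_le_card_nsmul _ _ (Real.sqrt M * Real.sqrt (stabilizerFidelity φ))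
      fun i _ => ?_).trans ?_
    · rw [inner_smul_right, norm_mul]
      refine mul_le_mul (Real.le_sqrt_of_sq_le (hα i)) ?_ (norm_nonneg _) (Real.sqrt_nonneg _)
      rw [norm_inner_symm]
      exact Real.le_sqrt_of_sq_le (hs i).norm_inner_sq_le
    · simp [mul_assoc]
  refine h1.trans (mul_le_mul_of_nonneg_right ?_ (Real.sqrt_nonneg _))
  have h2 : (2 * (k : ℝ)) ^ ((2 * (k : ℝ) + 1) / 2) =
      Real.sqrt ((2 * (k : ℝ)) ^ (2 * k + 1)) := by
    rw [Real.sqrt_eq_rpow, ← Real.rpow_natCast, ← Real.rpow_mul (by positivity)]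
    congr 1
    push_cast
    ring
  rw [h2, ← Real.sqrt_mul (Real.exp_pos _).le]
  refine Real.le_sqrt_of_sq_le ?_
  rwa [mul_pow, Real.sq_sqrt hM0]

theorem stabilizerRank_pos {n : ℕ} {ψ : Qubits n} (hψ : ψ ≠ 0) : 0 < stabilizerRank ψ := by
  obtain ⟨α, s, -, h⟩ := exists_stabilizer_decomposition ψ
  by_contra! h0
  have : IsEmpty (Fin (stabilizerRank ψ)) := by
    rw [Nat.le_zero.1 h0]
    infer_instance
  exact hψ (by rw [h, Fintype.sum_empty])

/-- If `k` were smaller, then `2 * k ≤ n`, and the logarithm of the right side of `h` would be at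
most `1 / 2 + 3 / 2 * k * log n`, too small against `c * n * log 2`. -/
theorem div_log_le_of_two_rpow_le {c : ℝ} (hc : 0 < c) {n k : ℕ} (hn : 2 ≤ n) (hk : 0 < k)
    (h : (2 : ℝ) ^ (c * (n : ℝ)) ≤
      Real.sqrt (Real.exp 1) * (2 * (k : ℝ)) ^ ((2 * (k : ℝ) + 1) / 2)) :
    min (1 / 4) (c / 10) * ((n : ℝ) / Real.log n) ≤ k := by
  by_contra! hlt
  set c' : ℝ := min (1 / 4) (c / 10) with hc'
  have hc1 : c' ≤ 1 / 4 := min_le_left _ _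
  have hc2 : c' ≤ c / 10 := min_le_right _ _
  have hn2 : (2 : ℝ) ≤ n := by exact_mod_cast hn
  have hk1 : (1 : ℝ) ≤ k := by exact_mod_cast hk
  have hlog2 : 1 / 2 < Real.log 2 := by linarith [Real.log_two_gt_d9]
  have hlogn : 1 / 2 < Real.log n := hlog2.trans_le (Real.log_le_log (by norm_num) hn2)
  have hlog0 : 0 < Real.log n := by linarith
  rw [← mul_div_assoc, lt_div_iff₀ hlog0] at hlt
  -- Here `log n > 1 / 2`; then `c' ≤ 1 / 4` yields `2 * k ≤ n`.
  have hk2 : (k : ℝ) ≤ 2 * (c' * n) := by nlinarith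
  have h2kn : 2 * (k : ℝ) ≤ n := by nlinarith
  have hL : Real.log (2 * k) ≤ Real.log n := Real.log_le_log (by positivity) h2kn
  have hlog := Real.log_le_log (by positivity) h
  rw [Real.log_rpow (by norm_num), Real.log_mul (by positivity) (by positivity),
    Real.log_rpow (by positivity), Real.log_sqrt (Real.exp_pos _).le, Real.log_exp] at hlog
  have h3 : (2 * (k : ℝ) + 1) / 2 * Real.log (2 * k) ≤ 3 / 2 * (k * Real.log n) := by
    calc (2 * (k : ℝ) + 1) / 2 * Real.log (2 * k)
        ≤ (2 * (k : ℝ) + 1) / 2 * Real.log n := by gcongr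
      _ ≤ 3 / 2 * k * Real.log n := by
        gcongr
        linarith
      _ = 3 / 2 * (k * Real.log n) := by ring
  have h4 : c * n * (1 / 2) ≤ c * n * Real.log 2 := by gcongr
  have h5 : c' * n ≤ c / 10 * n := by gcongr
  have h6 : 0 < c * n := by positivity
  -- As `1 ≤ k ≤ 2 * c' * n ≤ c * n / 5`, we have `c * n ≥ 5`, which absorbs the additive `1 / 2`
  -- coming from `√e`.
  linarith

end Stabilizer

theorem theorem2 :
    (∀ (n : ℕ) (φ ψ : Stabilizer.Qubits n), ‖φ‖ = 1 → ‖ψ‖ = 1 →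
      0 < Stabilizer.stabilizerFidelity φ ∧
      ‖inner ℂ φ ψ‖ / Real.sqrt (Stabilizer.stabilizerFidelity φ) ≤
        Real.sqrt (Real.exp 1) * (2 * (Stabilizer.stabilizerRank ψ : ℝ)) ^
          ((2 * (Stabilizer.stabilizerRank ψ : ℝ) + 1) / 2)) ∧
    (∀ c : ℝ, 0 < c → ∃ c' : ℝ, 0 < c' ∧
      ∀ (n : ℕ), 2 ≤ n → ∀ (φ ψ : Stabilizer.Qubits n), ‖φ‖ = 1 → ‖ψ‖ = 1 →
        (2 : ℝ) ^ (c * (n : ℝ)) ≤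
          ‖inner ℂ φ ψ‖ / Real.sqrt (Stabilizer.stabilizerFidelity φ) →
        c' * ((n : ℝ) / Real.log (n : ℝ)) ≤ (Stabilizer.stabilizerRank ψ : ℝ)) := by
  have hne : ∀ {n : ℕ} {φ : Stabilizer.Qubits n}, ‖φ‖ = 1 → φ ≠ 0 := fun h =>
    norm_ne_zero_iff.1 (by rw [h]; exact one_ne_zero)
  refine ⟨fun n φ ψ hφ hψ => ⟨Stabilizer.stabilizerFidelity_pos (hne hφ),
    Stabilizer.norm_inner_div_sqrt_fidelity_le (hne hφ) hψ⟩, fun c hc => ?_⟩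
  refine ⟨min (1 / 4) (c / 10), by positivity, fun n hn φ ψ hφ hψ h => ?_⟩
  exact Stabilizer.div_log_le_of_two_rpow_le hc hn (Stabilizer.stabilizerRank_pos (hne hψ))
    (h.trans (Stabilizer.norm_inner_div_sqrt_fidelity_le (hne hφ) hψ))
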